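/- Let $G$ be a finite directed multigraph (self-loops and multiple edges allowed) with a global sink $s$, i.e. a vertex without outgoing edges to which there is a directed path from every vertex, and fix for each vertex $v$ a cyclic ordering $e\mapsto e^+$ of the edges with tail $v$. Let $V'$ be the set of vertices other than $s$. Let $\Delta'$ be the matrix obtained from the Laplacian $\Delta=D-A$ by deleting the row and column of $s$, where $D$ is the diagonal matrix of out-degrees and $A_{vw}$ is the number of edges from $v$ to $w$. The sandpile group is $\mathcal S(G)=\mathbb Z^{V'}/\mathbb Z^{V'}\Delta'$, the quotient by the integer row span of $\Delta'$. A chip configuration is a vector $\sigma\in\mathbb Z_{\ge 0}^{V'}$; $[\sigma]$ is its class in $\mathcal S(G)$, and $\mathbf 1_v$ is the configuration with a single chip at $v$. A rotor configuration $\rho$ assigns to each $v\in V'$ an edge $\rho(v)$ with tail $v$; it is acyclic if the edges $\rho(v)$ contain no directed cycle. Acyclic rotor configurations are identified with the oriented spanning trees of $G$ rooted at $s$ (acyclic sets of edges that contain exactly one edge with tail $v$ for each $v\in V'$) by $\rho\mapsto\{\rho(v):v\in V'\}$. A chip at $v\in V'$ is routed for one step by replacing $\rho(v)$ with $\rho(v)^+$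 and moving the chip to the head of $\rho(v)^+$; chips that arrive at $s$ disappear. For $v\in V'$ the chip addition operator $E_v$ sends $\rho$ to the rotor configuration obtained by adding one chip at $v$ and routing it until it reaches $s$. For a chip configuration $\sigma$, let $\sigma(\rho)$ be the rotor configuration obtained by adding $\sigma(v)$ chips at each $v\in V'$ and routing them one step at a time, in any order, until all have reached $s$. The rotor-router group of $G$ is the subgroup, generated by the operators $E_v$ ($v\in V'$), of the group of permutations of the oriented spanning trees of $G$ rooted at $s$. Then: 1. A single chip started anywhere with any rotor configuration reaches $s$ after finitely many steps, so that $E_v$ is well defined; for every chip configuration $\sigma$ and rotor configuration $\rho$, all the chips can be routed to $s$ and $\sigma(\rho)$ does not depend on the order of the routings. 2. Each $E_v$ restricts to a bijection of the set of acyclic rotor configurations onto itself, and $G$ has at least one oriented spanning tree rooted at $s$. 3. The rotor-router group is isomorphic to $\mathcal S(G)$. More precisely, there is a group isomorphism $\Phi$ from $\mathcal S(G)$ onto the rotor-router group such that $\Phi([\mathbf 1_v])=E_v$ for all $v\in V'$, and $\Phi([\sigma])\rho=\sigma(\rho)$ for every chip configuration $\sigma$ and acyclic rotor configuration $\rho$.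 In particular $\sigma(\rho)$ depends only on $[\sigma]$ and $\rho$. 4. The resulting action of $\mathcal S(G)$ on the oriented spanning trees is transitive (for any two trees $\rho,\rho'$ there is a chip configuration $\sigma$ with $\sigma(\rho)=\rho'$) and free (if $g\in\mathcal S(G)$ and $\Phi(g)\rho=\rho$ for some tree $\rho$, then $g$ is the identity). -/

import Mathlib

/-- A directed multigraph: self-loops and multiple edges are allowed. -/
structure MultiDigraph (V : Type*) (E : Type*) where
  tail : E → V
  head : E → V

namespace MultiDigraph

variable {V : Type*} {E : Type*} (G : MultiDigraph V E)

/-- A vertex without outgoing edges. -/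
def IsSink (v : V) : Prop := ∀ e : E, G.tail e ≠ v

/-- There is an edge of the set `T` from `a` to `b`. -/
def AdjIn (T : Set E) (a b : V) : Prop := ∃ e ∈ T, G.tail e = a ∧ G.head e = b

/-- A sink to which there is a directed path from every vertex. -/
def IsGlobalSink (s : V) : Prop :=
  G.IsSink s ∧ ∀ v : V, Relation.ReflTransGen (G.AdjIn Set.univ) v s

/-- The set of edges `T` contains no directed cycle (a self-loop is a directed cycle). -/
def IsAcyclicEdgeSet (T : Set E) : Prop := ∀ v : V, ¬ Relation.TransGen (G.AdjIn T) v v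

/-- The non-sink vertices. -/
abbrev NonSink : Type _ := {v : V // ¬ G.IsSink v}

/-- Number of edges with tail `v`. -/
noncomputable def outdeg (v : V) : ℕ := Nat.card {e : E // G.tail e = v}

/-- Number of edges from `v` to `w`. -/
noncomputable def edgeCount (v w : V) : ℕ := Nat.card {e : E // G.tail e = v ∧ G.head e = w}

open Classical in
/-- The graph Laplacian `D - A`. -/
noncomputable def laplacian : Matrix V V ℤ :=
  Matrix.diagonal (fun v => (G.outdeg v : ℤ)) - Matrix.of (fun v w => (G.edgeCount v w : ℤ))

/-- The Laplacian with the rows and columns of sinks deleted; if there is a global sink, it is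
the only sink. -/
noncomputable def reducedLaplacian : Matrix G.NonSink G.NonSink ℤ :=
  G.laplacian.submatrix Subtype.val Subtype.val

/-- The sandpile group: integer vectors modulo the integer row span of the reduced Laplacian. -/
abbrev SandpileGroup : Type _ :=
  (G.NonSink → ℤ) ⧸ AddSubgroup.closure (Set.range fun v => G.reducedLaplacian v)

/-- A number of chips on each non-sink vertex. -/
abbrev ChipConfig : Type _ := G.NonSink → ℕ

/-- The class of a chip configuration in the sandpile group. -/
noncomputable def chipClass (σ : G.ChipConfig) : G.SandpileGroup :=
  QuotientAddGroup.mk (fun v => (σ v : ℤ))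

open Classical in
/-- A single chip at `v`. -/
noncomputable def singleChip (v : G.NonSink) : G.ChipConfig := Pi.single v 1

/-- An outgoing edge for each non-sink vertex. -/
abbrev RotorConfig : Type _ := (v : G.NonSink) → {e : E // G.tail e = v}

/-- The set of edges used by a rotor configuration. -/
def rotorEdges (ρ : G.RotorConfig) : Set E := Set.range fun v => (ρ v : E)

/-- The rotors form no directed cycle. -/
def IsAcyclicRotor (ρ : G.RotorConfig) : Prop := G.IsAcyclicEdgeSet (G.rotorEdges ρ)

/-- The edge set of an acyclic subgraph in which every non-sink vertex has out-degree one. -/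
def IsOrientedSpanningTree (T : Set E) : Prop :=
  (∀ v : G.NonSink, ∃! e, e ∈ T ∧ G.tail e = v) ∧ G.IsAcyclicEdgeSet T

/-- Oriented spanning trees, as edge sets; if there is a global sink, it is the root. -/
abbrev OrientedSpanningTree : Type _ := {T : Set E // G.IsOrientedSpanningTree T}

theorem mem_rotorEdges_iff (ρ : G.RotorConfig) (v : G.NonSink) (e : E) :
    (e ∈ G.rotorEdges ρ ∧ G.tail e = v) ↔ e = ρ v := by
  constructor
  · rintro ⟨⟨w, rfl⟩, h⟩
    have hw : w = v := Subtype.ext ((ρ w).2.symm.trans h)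
    subst hw
    rfl
  · rintro rfl
    exact ⟨⟨v, rfl⟩, (ρ v).2⟩

/-- The identification of acyclic rotor configurations with oriented spanning trees:
a rotor configuration is sent to the set of its edges. -/
noncomputable def treeEquiv : {ρ : G.RotorConfig // G.IsAcyclicRotor ρ} ≃ G.OrientedSpanningTree :=
  Equiv.ofBijective
    (fun ρ => ⟨G.rotorEdges ρ.1,
      fun v => ⟨ρ.1 v, (G.mem_rotorEdges_iff ρ.1 v _).2 rfl,
        fun e he => (G.mem_rotorEdges_iff ρ.1 v e).1 he⟩, ρ.2⟩)
    (by
      constructor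
      · intro ρ ρ' h
        have h' : G.rotorEdges ρ.1 = G.rotorEdges ρ'.1 := congrArg Subtype.val h
        refine Subtype.ext (funext fun v => Subtype.ext ?_)
        rw [← G.mem_rotorEdges_iff ρ'.1 v, ← h']
        exact (G.mem_rotorEdges_iff ρ.1 v _).2 rfl
      · rintro ⟨T, hT, hac⟩
        have hT' := hT
        choose f hf huniq using hT'
        have hE : G.rotorEdges (fun v => ⟨f v, (hf v).2⟩) = T := by
          ext e
          constructor
          · rintro ⟨v, rfl⟩
            exact (hf v).1
          · intro he
            have hns : ¬ G.IsSink (G.tail e) := fun h => h e rfl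
            exact ⟨⟨G.tail e, hns⟩, (huniq ⟨G.tail e, hns⟩ e ⟨he, rfl⟩).symm⟩
        refine ⟨⟨fun v => ⟨f v, (hf v).2⟩, ?_⟩, Subtype.ext hE⟩
        rw [IsAcyclicRotor, hE]
        exact hac)

/-- A cyclic ordering of the edges emanating from each vertex: `next e` is the edge after `e`,
and the cycles of `next` are exactly the sets of edges with a common tail. -/
structure CyclicOrdering where
  next : Equiv.Perm E
  sameCycle_iff : ∀ e f : E, next.SameCycle e f ↔ G.tail e = G.tail f

namespace CyclicOrdering

variable {G} (R : G.CyclicOrdering)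

theorem tail_next (e : E) : G.tail (R.next e) = G.tail e :=
  ((R.sameCycle_iff e (R.next e)).1 ⟨1, by simp⟩).symm

open Classical in
/-- Advance the rotor at `v` to the next edge. -/
noncomputable def advance (ρ : G.RotorConfig) (v : G.NonSink) : G.RotorConfig :=
  Function.update ρ v ⟨R.next (ρ v), (R.tail_next _).trans (ρ v).2⟩

open Classical in
/-- The rotor-router operation on single-chip-and-rotor states: advance the rotor at the chip's
location, then move the chip along it. States with the chip at a sink are absorbing. -/
noncomputable def step (x : V × G.RotorConfig) : V × G.RotorConfig :=
  if h : G.IsSink x.1 then x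
  else (G.head (R.next (x.2 ⟨x.1, h⟩)), R.advance x.2 ⟨x.1, h⟩)

/-- A chip started at `v` with rotors `ρ` arrives at a sink. -/
def ReachesSink (v : G.NonSink) (ρ : G.RotorConfig) : Prop :=
  ∃ n : ℕ, G.IsSink (R.step^[n] (v, ρ)).1

open Classical in
/-- The chip addition operator `E_v` on rotor configurations: add a chip at `v`, iterate the
rotor-router operation until the chip is at the sink, and keep the resulting rotors.
(The second branch is a default for the case that the chip never arrives.) -/
noncomputable def chipAddition (v : G.NonSink) (ρ : G.RotorConfig) : G.RotorConfig :=
  if h : R.ReachesSink v ρ then (R.step^[Nat.find h] (v, ρ)).2 else ρ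

open Classical in
/-- Firing in a chip-and-rotor state: at a vertex `v` that has a chip, the rotor is advanced and
one chip moves from `v` along it, disappearing if it arrives at a sink. -/
def Fires (x y : G.ChipConfig × G.RotorConfig) : Prop :=
  ∃ v : G.NonSink, 0 < x.1 v ∧
    y = (fun u => x.1 u - (if u = v then 1 else 0)
          + (if (u : V) = G.head (R.next (x.2 v)) then 1 else 0),
        R.advance x.2 v)

/-- `ρ' = σ(ρ)`: adding `σ v` chips at each `v` to `ρ` and routing all of them to the sink, in
some order, leads to `ρ'`. -/
def RoutesTo (σ : G.ChipConfig) (ρ ρ' : G.RotorConfig) : Prop :=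
  Relation.ReflTransGen R.Fires (σ, ρ) (0, ρ')

/-- The permutation `π` of the oriented spanning trees is the one given by `E_v`. -/
def IsChipAdditionPerm (v : G.NonSink) (π : Equiv.Perm G.OrientedSpanningTree) : Prop :=
  ∀ ρ : {ρ : G.RotorConfig // G.IsAcyclicRotor ρ},
    (π (G.treeEquiv ρ) : Set E) = G.rotorEdges (R.chipAddition v ρ)

/-- The rotor-router group: the group of permutations of oriented spanning trees generated by the
chip addition operators. -/
def rotorRouterGroup : Subgroup (Equiv.Perm G.OrientedSpanningTree) :=
  Subgroup.closure {π | ∃ v : G.NonSink, R.IsChipAdditionPerm v π}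

end CyclicOrdering

end MultiDigraph

/-! Firings at different vertices commute, so routing is confluent (`fires_diamond`,
`routes_confluent`). A chip that never stopped would use some edge infinitely often, hence all edges
at its tail, hence would reach the sink (`reachesSink`). So `σ(ρ)` is well defined and additive in
`σ`.

For bijectivity of `E_v`, the sink is joined to `v`, so that a chip at the sink restarts at `v`. The
states in which every vertex leads to the chip are preserved by this recurrent walk, and the walk is
injective on them (`injOn_recurrentStep`). With the chip at `s`, these states are exactly the
acyclic rotor configurations, and `E_v` is the first-return map to `s`. It is therefore injective,
and bijective by finiteness.

The operators commute and satisfy the Laplacian relations, because `outdeg v` firings at `v` turn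
its rotor full circle. This gives a homomorphism from the sandpile group (`exists_hom_actsAs`).
Freeness comes from an invariant: a potential `h` on edges with values in the sandpile group makes
`[σ] + ∑ v, h (ρ v)` constant under firing (`chipClass_eq_of_routesTo`), so `ρ` and `σ(ρ)` determine
`[σ]`. For transitivity, enough chips can turn all rotors of one tree into those of another
(`exists_routes`); the chips left over are undone by an inverse in a finite group. -/

namespace MultiDigraph

/-! ### Arithmetic of chip configurations and their classes. -/

section Chips

variable {V : Type*} {E : Type*} (G : MultiDigraph V E)

open Classical in
/-- One chip at `w`, or none if `w` is a sink. -/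
noncomputable def chipAt (w : V) : G.ChipConfig := fun u => if (u : V) = w then 1 else 0

theorem singleChip_eq (v : G.NonSink) : G.singleChip v = G.chipAt v := by
  funext u
  by_cases h : u = v
  · simp [singleChip, chipAt, h]
  · simp [singleChip, chipAt, h, Subtype.ext_iff.not.1 h]

theorem chipAt_of_isSink {w : V} (h : G.IsSink w) : G.chipAt w = 0 := by
  funext u
  have : (u : V) ≠ w := fun hu => u.2 (hu ▸ h)
  simp [chipAt, this]

theorem chipAt_self (v : G.NonSink) : G.chipAt v v = 1 := by simp [chipAt]

theorem chipAt_of_ne {u v : G.NonSink} (h : u ≠ v) : G.chipAt v u = 0 := by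
  simp [chipAt, Subtype.ext_iff.not.1 h]

theorem exists_eq_chipAt_add {σ : G.ChipConfig} {v : G.NonSink} (h : 0 < σ v) :
    ∃ τ, σ = G.chipAt v + τ := by
  refine ⟨σ - G.chipAt v, funext fun u => ?_⟩
  by_cases hu : u = v
  · subst hu
    simp only [Pi.add_apply, Pi.sub_apply, chipAt_self]
    omega
  · simp [chipAt_of_ne G hu]

theorem chipConfig_induction [Finite V] {P : G.ChipConfig → Prop} (zero : P 0)
    (add : ∀ σ τ, P σ → P τ → P (σ + τ)) (chip : ∀ v : G.NonSink, P (G.chipAt v))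
    (σ : G.ChipConfig) : P σ := by
  classical
  have := Fintype.ofFinite V
  have hsmul : ∀ (n : ℕ) (v : G.NonSink), P (n • G.chipAt v) := by
    intro n v
    induction n with
    | zero => simpa using zero
    | succ n ih => rw [succ_nsmul]; exact add _ _ ih (chip v)
  have hσ : σ = ∑ v, σ v • G.chipAt v := by
    funext u
    rw [Finset.sum_apply, Finset.sum_eq_single u]
    · simp [chipAt_self]
    · intro b _ hb
      simp [chipAt_of_ne G hb.symm]
    · simp
  rw [hσ]
  exact Finset.sum_induction _ P add zero fun v _ => hsmul _ v

theorem chipClass_add (σ τ : G.ChipConfig) :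
    G.chipClass (σ + τ) = G.chipClass σ + G.chipClass τ := by
  rw [chipClass, chipClass, chipClass, ← QuotientAddGroup.mk_add]
  congr 1

theorem chipClass_zero : G.chipClass 0 = 0 := by
  rw [chipClass, ← QuotientAddGroup.mk_zero]
  congr 1

theorem chipClass_nsmul (n : ℕ) (σ : G.ChipConfig) :
    G.chipClass (n • σ) = n • G.chipClass σ := by
  induction n with
  | zero => simp [chipClass_zero]
  | succ n ih => rw [succ_nsmul, succ_nsmul, chipClass_add, ih]

theorem chipClass_sum {ι : Type*} (t : Finset ι) (f : ι → G.ChipConfig) :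
    G.chipClass (∑ i ∈ t, f i) = ∑ i ∈ t, G.chipClass (f i) := by
  classical
  induction t using Finset.induction_on with
  | empty => simp [chipClass_zero]
  | insert a t ha ih => rw [Finset.sum_insert ha, Finset.sum_insert ha, chipClass_add, ih]

theorem rotorEdges_injective : Function.Injective G.rotorEdges := by
  intro ρ ρ' h
  refine funext fun v => Subtype.ext ?_
  rw [← G.mem_rotorEdges_iff ρ' v, ← h]
  exact (G.mem_rotorEdges_iff ρ v _).2 rfl

end Chips

/-! ### The abelian property of routing. -/

namespace CyclicOrdering

variable {V : Type*} {E : Type*} {G : MultiDigraph V E} (R : G.CyclicOrdering)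

theorem advance_self (ρ : G.RotorConfig) (v : G.NonSink) :
    (R.advance ρ v v : E) = R.next (ρ v) := by simp [advance]

theorem advance_of_ne (ρ : G.RotorConfig) {u v : G.NonSink} (h : u ≠ v) :
    R.advance ρ v u = ρ u := by simp [advance, h]

theorem advance_comm (ρ : G.RotorConfig) (v w : G.NonSink) :
    R.advance (R.advance ρ v) w = R.advance (R.advance ρ w) v := by
  by_cases hvw : v = w
  · rw [hvw]
  · funext u
    by_cases hv : u = v
    · subst hv
      refine Subtype.ext ?_
      rw [R.advance_of_ne _ hvw, R.advance_self, R.advance_self, R.advance_of_ne _ hvw]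
    · by_cases hw : u = w
      · subst hw
        refine Subtype.ext ?_
        rw [R.advance_of_ne _ hv, R.advance_self, R.advance_self, R.advance_of_ne _ hv]
      · simp only [R.advance_of_ne _ hv, R.advance_of_ne _ hw]

theorem advance_injective (v : G.NonSink) : Function.Injective fun ρ => R.advance ρ v := by
  intro ρ ρ' h
  funext u
  have hu := congrFun h u
  by_cases huv : u = v
  · subst huv
    have := congrArg Subtype.val hu
    simp only [advance_self] at this
    exact Subtype.ext (R.next.injective this)
  · simpa only [R.advance_of_ne _ huv] using hu

/-- Splitting off the fired chip removes the truncated subtraction from `Fires`; everything later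
uses this additive form. -/
theorem fires_iff {σ : G.ChipConfig} {ρ : G.RotorConfig} {y : G.ChipConfig × G.RotorConfig} :
    R.Fires (σ, ρ) y ↔ ∃ (v : G.NonSink) (τ : G.ChipConfig), σ = G.chipAt v + τ ∧
      y = (τ + G.chipAt (G.head (R.next (ρ v))), R.advance ρ v) := by
  have key : ∀ (v : G.NonSink) (τ : G.ChipConfig), (open Classical in
      (fun u => (G.chipAt v + τ) u - (if u = v then 1 else 0)
        + (if (u : V) = G.head (R.next (ρ v)) then 1 else 0)) : G.ChipConfig)
      = τ + G.chipAt (G.head (R.next (ρ v))) := by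
    intro v τ
    funext u
    by_cases hu : u = v
    · subst hu
      simp only [Pi.add_apply, chipAt_self, if_true]
      rw [Nat.add_sub_cancel_left, chipAt]
    · simp only [Pi.add_apply, G.chipAt_of_ne hu, if_neg hu, zero_add, Nat.sub_zero]
      rw [chipAt]
  constructor
  · rintro ⟨v, hv, rfl⟩
    obtain ⟨τ, rfl⟩ := G.exists_eq_chipAt_add hv
    exact ⟨v, τ, rfl, Prod.ext (key v τ) rfl⟩
  · rintro ⟨v, τ, rfl, rfl⟩
    exact ⟨v, by simp [chipAt_self], Prod.ext (key v τ).symm rfl⟩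

theorem fires_chipAt_add (v : G.NonSink) (τ : G.ChipConfig) (ρ : G.RotorConfig) :
    R.Fires (G.chipAt v + τ, ρ) (τ + G.chipAt (G.head (R.next (ρ v))), R.advance ρ v) :=
  R.fires_iff.2 ⟨v, τ, rfl, rfl⟩

/-- Firing is deterministic at a given vertex. Firings at distinct vertices turn different rotors
and neither uses up the other's chip, so they commute. -/
theorem fires_diamond {a b c : G.ChipConfig × G.RotorConfig} (hb : R.Fires a b)
    (hc : R.Fires a c) : b = c ∨ ∃ d, R.Fires b d ∧ R.Fires c d := by
  obtain ⟨σ, ρ⟩ := a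
  obtain ⟨v, τ, rfl, rfl⟩ := R.fires_iff.1 hb
  obtain ⟨w, τ', hσ, rfl⟩ := R.fires_iff.1 hc
  by_cases hvw : v = w
  · subst hvw
    rw [add_left_cancel hσ]
    exact Or.inl rfl
  · right
    have hpos : 0 < τ w := by
      have := congrFun hσ w
      simp only [Pi.add_apply, chipAt_self, G.chipAt_of_ne (Ne.symm hvw)] at this
      omega
    obtain ⟨κ, rfl⟩ := G.exists_eq_chipAt_add hpos
    have hτ' : τ' = G.chipAt v + κ := by
      rw [add_left_comm] at hσ
      exact (add_left_cancel hσ).symm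
    subst hτ'
    refine ⟨(κ + G.chipAt (G.head (R.next (ρ v))) + G.chipAt (G.head (R.next (ρ w))),
      R.advance (R.advance ρ v) w), ?_, ?_⟩
    · have := R.fires_chipAt_add w (κ + G.chipAt (G.head (R.next (ρ v)))) (R.advance ρ v)
      rwa [R.advance_of_ne ρ (Ne.symm hvw), ← add_assoc] at this
    · have := R.fires_chipAt_add v (κ + G.chipAt (G.head (R.next (ρ w)))) (R.advance ρ w)
      rwa [R.advance_of_ne ρ hvw, ← add_assoc, R.advance_comm ρ w v, add_right_comm κ] at this

theorem routes_confluent {a b c : G.ChipConfig × G.RotorConfig}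
    (hb : Relation.ReflTransGen R.Fires a b) (hc : Relation.ReflTransGen R.Fires a c) :
    Relation.Join (Relation.ReflTransGen R.Fires) b c := by
  refine Relation.church_rosser (fun a b c hb hc => ?_) hb hc
  rcases R.fires_diamond hb hc with rfl | ⟨d, hbd, hcd⟩
  · exact ⟨b, .refl, .refl⟩
  · exact ⟨d, .single hbd, .single hcd⟩

theorem eq_of_routes_of_zero {ρ : G.RotorConfig} {y : G.ChipConfig × G.RotorConfig}
    (h : Relation.ReflTransGen R.Fires (0, ρ) y) : y = (0, ρ) := by
  rcases h.cases_head with h | ⟨c, ⟨v, hv, -⟩, -⟩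
  · exact h.symm
  · exact absurd hv (by simp)

/-- By confluence, and because a state without chips admits no firing, a partial routing always
continues to the same final state. -/
theorem RoutesTo.of_routes {σ τ : G.ChipConfig} {ρ ρ₁ ρ' : G.RotorConfig}
    (h : R.RoutesTo σ ρ ρ') (h' : Relation.ReflTransGen R.Fires (σ, ρ) (τ, ρ₁)) :
    R.RoutesTo τ ρ₁ ρ' := by
  obtain ⟨d, hd, hd'⟩ := R.routes_confluent h h'
  rw [R.eq_of_routes_of_zero hd] at hd'
  exact hd'

theorem RoutesTo.unique {σ : G.ChipConfig} {ρ ρ₁ ρ₂ : G.RotorConfig}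
    (h₁ : R.RoutesTo σ ρ ρ₁) (h₂ : R.RoutesTo σ ρ ρ₂) : ρ₁ = ρ₂ :=
  congrArg Prod.snd (R.eq_of_routes_of_zero (RoutesTo.of_routes R h₂ h₁)).symm

theorem routes_add_right {σ τ : G.ChipConfig} {ρ ρ' : G.RotorConfig} (κ : G.ChipConfig)
    (h : Relation.ReflTransGen R.Fires (σ, ρ) (τ, ρ')) :
    Relation.ReflTransGen R.Fires (σ + κ, ρ) (τ + κ, ρ') := by
  refine Relation.ReflTransGen.lift (r := R.Fires)
    (fun x : G.ChipConfig × G.RotorConfig => (x.1 + κ, x.2)) ?_ _ _ h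
  rintro ⟨σ, ρ⟩ y hy
  obtain ⟨v, τ, rfl, rfl⟩ := R.fires_iff.1 hy
  exact R.fires_iff.2 ⟨v, τ + κ, add_assoc _ _ _, by simp only [add_right_comm]⟩

theorem routesTo_zero (ρ : G.RotorConfig) : R.RoutesTo 0 ρ ρ := .refl

theorem RoutesTo.add {σ τ : G.ChipConfig} {ρ ρ₁ ρ₂ : G.RotorConfig}
    (h : R.RoutesTo σ ρ ρ₁) (h' : R.RoutesTo τ ρ₁ ρ₂) : R.RoutesTo (σ + τ) ρ ρ₂ := by
  have := R.routes_add_right τ h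
  rw [zero_add] at this
  exact this.trans h'

theorem step_of_isSink {x : V × G.RotorConfig} (h : G.IsSink x.1) : R.step x = x := by
  simp [step, h]

theorem step_of_not_isSink {w : V} {ρ : G.RotorConfig} (h : ¬ G.IsSink w) :
    R.step (w, ρ) = (G.head (R.next (ρ ⟨w, h⟩)), R.advance ρ ⟨w, h⟩) := by
  simp [step, h]

theorem routes_step (x : V × G.RotorConfig) :
    Relation.ReflTransGen R.Fires (G.chipAt x.1, x.2) (G.chipAt (R.step x).1, (R.step x).2) := by
  obtain ⟨w, ρ⟩ := x
  by_cases h : G.IsSink w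
  · rw [R.step_of_isSink (x := (w, ρ)) h]
  · rw [R.step_of_not_isSink h]
    have := R.fires_chipAt_add ⟨w, h⟩ 0 ρ
    rw [add_zero, zero_add] at this
    exact .single this

theorem routes_step_iterate (x : V × G.RotorConfig) (n : ℕ) :
    Relation.ReflTransGen R.Fires (G.chipAt x.1, x.2)
      (G.chipAt (R.step^[n] x).1, (R.step^[n] x).2) := by
  induction n with
  | zero => exact .refl
  | succ n ih => rw [Function.iterate_succ_apply']; exact ih.trans (R.routes_step _)

theorem routesTo_chipAddition {v : G.NonSink} {ρ : G.RotorConfig} (h : R.ReachesSink v ρ) :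
    R.RoutesTo (G.chipAt v) ρ (R.chipAddition v ρ) := by
  classical
  have := R.routes_step_iterate ((v : V), ρ) (Nat.find h)
  rw [G.chipAt_of_isSink (Nat.find_spec h)] at this
  rw [chipAddition, dif_pos h, RoutesTo]
  convert this

end CyclicOrdering

end MultiDigraph

namespace MultiDigraph

theorem IsGlobalSink.eq_of_isSink {V : Type*} {E : Type*} {G : MultiDigraph V E} {s w : V}
    (hs : G.IsGlobalSink s) (hw : G.IsSink w) : w = s := by
  rcases (hs.2 w).cases_head with h | ⟨c, ⟨e, -, he, -⟩, -⟩
  · exact h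
  · exact absurd he (hw e)

/-! ### Every chip reaches the sink. -/

namespace CyclicOrdering

variable {V : Type*} {E : Type*} {G : MultiDigraph V E} (R : G.CyclicOrdering)

theorem exists_iterate_eq [Finite E] {e f : E} (h : G.tail e = G.tail f) :
    ∃ n : ℕ, R.next^[n] e = f := by
  obtain ⟨n, hn⟩ := ((R.sameCycle_iff e f).2 h).exists_nat_pow_eq
  exact ⟨n, by rw [← hn, Equiv.Perm.iterate_eq_pow]⟩

theorem tail_iterate (e : E) (n : ℕ) : G.tail (R.next^[n] e) = G.tail e := by
  induction n with
  | zero => rfl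
  | succ n ih => rw [Function.iterate_succ_apply', R.tail_next, ih]

open Filter in
-- On an infinite walk an edge `f` used infinitely often forces the same for `R.next f`, hence for
-- all edges with its tail. The property then spreads along a directed path to `s`, where the walk
-- would have stopped.
theorem reachesSink [Finite V] [Finite E] {s : V} (hs : G.IsGlobalSink s) (v : G.NonSink)
    (ρ : G.RotorConfig) : R.ReachesSink v ρ := by
  by_contra hnot
  have hns : ∀ n, ¬ G.IsSink (R.step^[n] ((v : V), ρ)).1 := fun n h => hnot ⟨n, h⟩
  set x : ℕ → V × G.RotorConfig := fun n => R.step^[n] ((v : V), ρ) with hx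
  let p : ℕ → G.NonSink := fun n => ⟨(x n).1, hns n⟩
  let e : ℕ → E := fun n => R.next ((x n).2 (p n))
  have hsucc : ∀ n, x (n + 1) = (G.head (e n), R.advance (x n).2 (p n)) := fun n => by
    simp only [hx, Function.iterate_succ_apply']
    exact R.step_of_not_isSink (hns n)
  have htail : ∀ n, G.tail (e n) = p n := fun n => (R.tail_next _).trans ((x n).2 (p n)).2
  have hnext : ∀ f, (∃ᶠ n in atTop, e n = f) → ∃ᶠ n in atTop, e n = R.next f := by
    intro f hf
    rw [frequently_atTop] at hf ⊢
    intro N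
    obtain ⟨n, hn, hen⟩ := hf N
    have hex : ∃ k, p (n + 1 + k) = p n := by
      obtain ⟨m, hm, hem⟩ := hf (n + 1)
      refine ⟨m - (n + 1), Subtype.ext ?_⟩
      rw [Nat.add_sub_cancel' hm, ← htail, ← htail, hen, hem]
    classical
    -- Until the first return to `p n` its rotor stays at `f`, so on that return the edge used is
    -- `R.next f`.
    have hrot : ∀ k ≤ Nat.find hex, ((x (n + 1 + k)).2 (p n) : E) = f := by
      intro k
      induction k with
      | zero =>
        intro _
        rw [add_zero, hsucc, R.advance_self]
        exact hen
      | succ k ih =>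
        intro hk
        have hne : p n ≠ p (n + 1 + k) := fun h => Nat.find_min hex hk h.symm
        rw [← add_assoc, hsucc]
        dsimp only
        rw [R.advance_of_ne _ hne]
        exact ih (Nat.le_of_succ_le hk)
    refine ⟨n + 1 + Nat.find hex, by omega, ?_⟩
    have h1 := hrot _ le_rfl
    have h2 := Nat.find_spec hex
    change R.next ((x (n + 1 + Nat.find hex)).2 (p (n + 1 + Nat.find hex))) = _
    rw [h2, h1]
  have hiter : ∀ f (k : ℕ), (∃ᶠ n in atTop, e n = f) → ∃ᶠ n in atTop, e n = R.next^[k] f := by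
    intro f k hf
    induction k with
    | zero => exact hf
    | succ k ih => rw [Function.iterate_succ_apply']; exact hnext _ ih
  have hedge : ∀ w, (∃ᶠ n in atTop, (p n : V) = w) → ∀ f, G.tail f = w →
      ∃ᶠ n in atTop, e n = f := by
    intro w hw f hf
    have : ∃ g, ∃ᶠ n in atTop, e n = g ∧ G.tail g = w := by
      by_contra hcon
      push Not at hcon
      refine hw ((eventually_all.2 hcon).mono fun n hn hpn => ?_)
      exact hn (e n) rfl ((htail n).trans hpn)
    obtain ⟨g, hg⟩ := this
    have hgw : G.tail g = w := hg.exists.choose_spec.2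
    obtain ⟨k, rfl⟩ := R.exists_iterate_eq (hgw.trans hf.symm)
    exact hiter g k (hg.mono fun n h => h.1)
  have hhead : ∀ f, (∃ᶠ n in atTop, e n = f) → ∃ᶠ n in atTop, (p n : V) = G.head f := by
    intro f hf
    rw [frequently_atTop] at hf ⊢
    intro N
    obtain ⟨n, hn, hen⟩ := hf N
    refine ⟨n + 1, by omega, ?_⟩
    change (x (n + 1)).1 = _
    rw [hsucc, hen]
  have hstart : ∃ w, ∃ᶠ n in atTop, (p n : V) = w := by
    by_contra hcon
    push Not at hcon
    exact (eventually_all.2 hcon).exists.elim fun n hn => hn (p n) rfl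
  obtain ⟨w, hw⟩ := hstart
  have hsink : ∃ᶠ n in atTop, (p n : V) = s := by
    induction hs.2 w using Relation.ReflTransGen.head_induction_on with
    | refl => exact hw
    | head h _ ih =>
      obtain ⟨f, -, hf, rfl⟩ := h
      exact ih (hhead f (hedge _ hw f hf))
  obtain ⟨n, hn⟩ := hsink.exists
  exact hns n (hn ▸ hs.1 : G.IsSink (p n : V))

theorem existsUnique_routesTo [Finite V] [Finite E] {s : V} (hs : G.IsGlobalSink s)
    (σ : G.ChipConfig) (ρ : G.RotorConfig) : ∃! ρ', R.RoutesTo σ ρ ρ' := by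
  refine existsUnique_of_exists_of_unique ?_ fun _ _ => RoutesTo.unique R
  induction σ using G.chipConfig_induction generalizing ρ with
  | zero => exact ⟨ρ, R.routesTo_zero ρ⟩
  | add σ τ hσ hτ =>
    obtain ⟨ρ₁, h₁⟩ := hσ ρ
    obtain ⟨ρ₂, h₂⟩ := hτ ρ₁
    exact ⟨ρ₂, RoutesTo.add R h₁ h₂⟩
  | chip v => exact ⟨_, R.routesTo_chipAddition (R.reachesSink hs v ρ)⟩

end CyclicOrdering

/-! ### Acyclic rotor configurations as functional graphs leading to the sink. -/

section Acyclic

variable {V : Type*} {E : Type*} (G : MultiDigraph V E)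

theorem adjIn_rotorEdges_iff (ρ : G.RotorConfig) (a b : V) :
    G.AdjIn (G.rotorEdges ρ) a b ↔ ∃ h : ¬ G.IsSink a, G.head (ρ ⟨a, h⟩) = b := by
  constructor
  · rintro ⟨_, ⟨v, rfl⟩, rfl, rfl⟩
    have hv : G.tail (ρ v) = v := (ρ v).2
    refine ⟨fun h => v.2 (hv ▸ h), ?_⟩
    have : ∀ h, (⟨G.tail (ρ v), h⟩ : G.NonSink) = v := fun _ => Subtype.ext hv
    rw [this]
  · rintro ⟨h, rfl⟩
    exact ⟨_, ⟨⟨a, h⟩, rfl⟩, (ρ ⟨a, h⟩).2, rfl⟩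

open Classical in
/-- The head of the rotor at a vertex, with sinks sent to `v`. -/
noncomputable def succAt (v : V) (ρ : G.RotorConfig) (u : V) : V :=
  if h : G.IsSink u then v else G.head (ρ ⟨u, h⟩)

/-- Without cycles, following rotors is well-founded on a finite set and ends at the only sink.
Conversely, the successor of a point on a cycle is on it too, so `s` would lie on a cycle although
it has no rotor. The value `v` at the sink plays no role. -/
theorem isAcyclicRotor_iff [Finite V] {s : V} (hs : G.IsGlobalSink s) (v : V)
    (ρ : G.RotorConfig) :
    G.IsAcyclicRotor ρ ↔ ∀ u, ∃ k, (G.succAt v ρ)^[k] u = s := by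
  constructor
  · intro h
    let r : V → V → Prop := fun a b => Relation.TransGen (G.AdjIn (G.rotorEdges ρ)) b a
    have : Std.Irrefl r := ⟨h⟩
    have : IsTrans V r := ⟨fun a b c hab hbc => hbc.trans hab⟩
    have wf : WellFounded r := Finite.wellFounded_of_trans_of_irrefl r
    intro u
    induction u using wf.induction with
    | h u ih =>
      by_cases hu : G.IsSink u
      · exact ⟨0, hs.eq_of_isSink hu⟩
      · obtain ⟨k, hk⟩ := ih (G.head (ρ ⟨u, hu⟩))
          (.single ((G.adjIn_rotorEdges_iff ρ _ _).2 ⟨hu, rfl⟩))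
        refine ⟨k + 1, ?_⟩
        rw [Function.iterate_succ_apply, succAt, dif_neg hu, hk]
  · intro h u hu
    obtain ⟨k, hk⟩ := h u
    induction k generalizing u with
    | zero =>
      obtain ⟨c, hc, -⟩ := Relation.TransGen.head'_iff.1 hu
      obtain ⟨hns, -⟩ := (G.adjIn_rotorEdges_iff ρ _ _).1 hc
      exact hns (by rw [show u = s from hk]; exact hs.1)
    | succ k ih =>
      obtain ⟨c, hc, hcu⟩ := Relation.TransGen.head'_iff.1 hu
      obtain ⟨hns, hc'⟩ := (G.adjIn_rotorEdges_iff ρ _ _).1 hc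
      refine ih c (.tail' hcu hc) ?_
      rwa [Function.iterate_succ_apply, succAt, dif_neg hns, hc'] at hk

/-- Rotors along shortest paths to `s` strictly decrease the distance `d`, so they cannot close a
cycle. -/
theorem exists_isAcyclicRotor {s : V} (hs : G.IsGlobalSink s) :
    ∃ ρ : G.RotorConfig, G.IsAcyclicRotor ρ := by
  classical
  -- `P n v` says that some path of exactly `n` edges leads from `v` to `s`.
  let P : ℕ → V → Prop := fun n =>
    Nat.rec (motive := fun _ => V → Prop) (fun v => v = s) (fun _ Q v => ∃ e, G.tail e = v ∧ Q (G.head e)) n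
  have hP : ∀ v, ∃ n, P n v := by
    intro v
    induction hs.2 v using Relation.ReflTransGen.head_induction_on with
    | refl => exact ⟨0, rfl⟩
    | head h _ ih =>
      obtain ⟨e, -, he, rfl⟩ := h
      obtain ⟨n, hn⟩ := ih
      exact ⟨n + 1, e, he, hn⟩
  let d : V → ℕ := fun v => Nat.find (hP v)
  have hstep : ∀ v : G.NonSink, ∃ e : {e : E // G.tail e = v},
      d (G.head e) < d v := by
    intro v
    have hspec : P (d v) v := Nat.find_spec (hP v)
    cases hn : d v with
    | zero =>
      rw [hn] at hspec
      exact absurd (hspec ▸ hs.1 : G.IsSink (v : V)) v.2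
    | succ n =>
      rw [hn] at hspec
      obtain ⟨e, he, hPe⟩ := hspec
      exact ⟨⟨e, he⟩, Nat.lt_succ_of_le (Nat.find_min' _ hPe)⟩
  choose ρ hρ using hstep
  refine ⟨ρ, fun v hv => ?_⟩
  have : ∀ a b, Relation.TransGen (G.AdjIn (G.rotorEdges ρ)) a b →
      d b < d a := by
    intro a b hab
    induction hab with
    | single h =>
      obtain ⟨ha, rfl⟩ := (G.adjIn_rotorEdges_iff ρ _ _).1 h
      exact hρ ⟨a, ha⟩
    | tail _ h ih =>
      obtain ⟨ha, rfl⟩ := (G.adjIn_rotorEdges_iff ρ _ _).1 h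
      exact (hρ ⟨_, ha⟩).trans ih
  exact lt_irrefl _ (this v v hv)

/-- All vertices lead to `w` when the rotors are followed and sinks lead to `v`. -/
def AllLeadTo (v : V) (x : V × G.RotorConfig) : Prop := ∀ u, ∃ k, (G.succAt v x.2)^[k] u = x.1

/-- A path to `w` may be cut at its first visit to `w`, so the rotor at `w` itself is irrelevant. -/
theorem AllLeadTo.congr {v w : V} {ρ ρ' : G.RotorConfig} (h : G.AllLeadTo v (w, ρ))
    (heq : ∀ u : G.NonSink, (u : V) ≠ w → ρ' u = ρ u) : G.AllLeadTo v (w, ρ') := by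
  intro u
  obtain ⟨k, hk⟩ := h u
  change (G.succAt v ρ)^[k] u = w at hk
  induction k generalizing u with
  | zero => exact ⟨0, hk⟩
  | succ k ih =>
    by_cases hu : u = w
    · exact ⟨0, hu⟩
    · rw [Function.iterate_succ_apply] at hk
      obtain ⟨l, hl⟩ := ih _ hk
      refine ⟨l + 1, ?_⟩
      have : G.succAt v ρ' u = G.succAt v ρ u := by
        unfold succAt
        split_ifs with h
        · rfl
        · rw [heq ⟨u, h⟩ hu]
      rw [Function.iterate_succ_apply]
      change (G.succAt v ρ')^[l] _ = w
      rw [this]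
      exact hl

end Acyclic

/-! ### The recurrent walk and bijectivity of `E_v`. -/

namespace CyclicOrdering

variable {V : Type*} {E : Type*} {G : MultiDigraph V E} (R : G.CyclicOrdering)

open Classical in
/-- Advance the rotor at `w`, if `w` is not a sink. -/
noncomputable def advanceAt (ρ : G.RotorConfig) (w : V) : G.RotorConfig :=
  if h : G.IsSink w then ρ else R.advance ρ ⟨w, h⟩

theorem advanceAt_of_ne (ρ : G.RotorConfig) {w : V} {u : G.NonSink} (h : (u : V) ≠ w) :
    R.advanceAt ρ w u = ρ u := by
  unfold advanceAt
  split_ifs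
  · rfl
  · exact R.advance_of_ne _ fun hu => h (congrArg Subtype.val hu)

theorem advanceAt_injective (w : V) : Function.Injective fun ρ => R.advanceAt ρ w := by
  unfold advanceAt
  split_ifs with h
  · exact Function.injective_id
  · exact R.advance_injective ⟨w, h⟩

/-- The rotor-router operation in which a chip at a sink moves to `v`. -/
noncomputable def recurrentStep (v : V) (x : V × G.RotorConfig) : V × G.RotorConfig :=
  (G.succAt v (R.advanceAt x.2 x.1) x.1, R.advanceAt x.2 x.1)

theorem recurrentStep_of_isSink {v : V} {x : V × G.RotorConfig} (h : G.IsSink x.1) :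
    R.recurrentStep v x = (v, x.2) := by
  simp [recurrentStep, succAt, advanceAt, h]

theorem recurrentStep_of_not_isSink {v : V} {x : V × G.RotorConfig} (h : ¬ G.IsSink x.1) :
    R.recurrentStep v x = R.step x := by
  simp [recurrentStep, succAt, advanceAt, h, step, advance_self]

theorem allLeadTo_advanceAt {v : V} {x : V × G.RotorConfig} (hx : G.AllLeadTo v x) :
    G.AllLeadTo v (x.1, R.advanceAt x.2 x.1) :=
  AllLeadTo.congr G hx fun _ => R.advanceAt_of_ne x.2

/-- Turning the rotor at the chip's location keeps every vertex leading there; one more step leads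
to the new location. -/
theorem mapsTo_recurrentStep (v : V) :
    Set.MapsTo (R.recurrentStep v) {x | G.AllLeadTo v x} {x | G.AllLeadTo v x} := by
  intro x hx u
  obtain ⟨k, hk⟩ := R.allLeadTo_advanceAt hx u
  exact ⟨k + 1, by rw [Function.iterate_succ_apply']; exact congrArg _ hk⟩

/-- After the rotor has turned, the old location of the chip is on a cycle of the successor map,
which is injective on periodic points. So the new state determines the old location, and then the
old rotor. -/
theorem injOn_recurrentStep (v : V) : Set.InjOn (R.recurrentStep v) {x | G.AllLeadTo v x} := by
  intro x hx y hy hxy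
  have hρ : R.advanceAt x.2 x.1 = R.advanceAt y.2 y.1 := congrArg Prod.snd hxy
  have hw := congrArg Prod.fst hxy
  simp only [recurrentStep] at hw
  have hper : ∀ z : V × G.RotorConfig, G.AllLeadTo v z →
      z.1 ∈ Function.periodicPts (G.succAt v (R.advanceAt z.2 z.1)) := by
    intro z hz
    obtain ⟨k, hk⟩ := R.allLeadTo_advanceAt hz (G.succAt v (R.advanceAt z.2 z.1) z.1)
    refine ⟨k + 1, k.succ_pos, ?_⟩
    rw [Function.IsPeriodicPt, Function.IsFixedPt, Function.iterate_succ_apply]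
    exact hk
  have hx1 := hper x hx
  have hy1 := hper y hy
  rw [hρ] at hx1 hw
  have h1 : x.1 = y.1 := (Function.bijOn_periodicPts _).injOn hx1 hy1 hw
  rw [h1] at hρ
  exact Prod.ext h1 (R.advanceAt_injective y.1 hρ)

theorem recurrentStep_iterate {v : V} {ρ : G.RotorConfig} {n : ℕ}
    (h : ∀ m < n, ¬ G.IsSink (R.step^[m] (v, ρ)).1) :
    (R.recurrentStep v)^[n] (v, ρ) = R.step^[n] (v, ρ) := by
  induction n with
  | zero => rfl
  | succ n ih =>
    rw [Function.iterate_succ_apply', Function.iterate_succ_apply',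
      ih fun m hm => h m (Nat.lt_succ_of_lt hm), R.recurrentStep_of_not_isSink (h n n.lt_succ_self)]

/-- `E_v` is the first return of the recurrent walk to `s`; the extra step moves the chip from `s`
to `v`. -/
theorem exists_recurrentStep_iterate {s : V} (hs : G.IsGlobalSink s) {v : G.NonSink}
    {ρ : G.RotorConfig} (h : R.ReachesSink v ρ) :
    ∃ n, (R.recurrentStep v)^[n + 1] (s, ρ) = (s, R.chipAddition v ρ) ∧
      ∀ m < n, ∀ ρ', (R.recurrentStep v)^[m + 1] (s, ρ) ≠ (s, ρ') := by
  classical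
  have hstart : R.recurrentStep v (s, ρ) = ((v : V), ρ) := R.recurrentStep_of_isSink hs.1
  have hmin : ∀ n ≤ Nat.find h, (R.recurrentStep v)^[n + 1] (s, ρ) = R.step^[n] ((v : V), ρ) := by
    intro n hn
    rw [Function.iterate_succ_apply, hstart]
    exact R.recurrentStep_iterate fun m hm => Nat.find_min h (hm.trans_le hn)
  refine ⟨Nat.find h, ?_, fun m hm ρ' heq => ?_⟩
  · rw [hmin _ le_rfl, chipAddition, dif_pos h]
    refine Prod.ext (hs.eq_of_isSink (Nat.find_spec h)) ?_
    convert rfl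
  · rw [hmin m hm.le] at heq
    exact Nat.find_min h hm (by rw [heq]; exact hs.1)

theorem bijOn_chipAddition [Finite V] [Finite E] {s : V} (hs : G.IsGlobalSink s)
    (v : G.NonSink) :
    Set.BijOn (R.chipAddition v) {ρ | G.IsAcyclicRotor ρ} {ρ | G.IsAcyclicRotor ρ} := by
  have hac : ∀ ρ, G.IsAcyclicRotor ρ ↔ G.AllLeadTo v (s, ρ) := G.isAcyclicRotor_iff hs v
  have hmaps : Set.MapsTo (R.chipAddition v) {ρ | G.IsAcyclicRotor ρ}
      {ρ | G.IsAcyclicRotor ρ} := by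
    intro ρ hρ
    obtain ⟨n, hn, -⟩ := R.exists_recurrentStep_iterate hs (R.reachesSink hs v ρ)
    refine (hac _).2 ?_
    rw [← hn]
    exact (R.mapsTo_recurrentStep v).iterate (n + 1) ((hac ρ).1 hρ)
  have hinj : Set.InjOn (R.chipAddition v) {ρ | G.IsAcyclicRotor ρ} := by
    intro ρ₁ h₁ ρ₂ h₂ heq
    obtain ⟨n₁, hn₁, hmin₁⟩ := R.exists_recurrentStep_iterate hs (R.reachesSink hs v ρ₁)
    obtain ⟨n₂, hn₂, hmin₂⟩ := R.exists_recurrentStep_iterate hs (R.reachesSink hs v ρ₂)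
    -- Cancelling the common `n₁ + 1` steps by injectivity leaves `d` steps from `(s, ρ₂)` to `(s,
    -- ρ₁)`; if `d > 0`, this is a return to `s` before the first one.
    have key : ∀ {ρ₁ ρ₂ : G.RotorConfig} {n₁ n₂ : ℕ}, G.IsAcyclicRotor ρ₁ →
        G.IsAcyclicRotor ρ₂ → n₁ ≤ n₂ →
        (R.recurrentStep v)^[n₁ + 1] (s, ρ₁) = (R.recurrentStep v)^[n₂ + 1] (s, ρ₂) →
        (∀ m < n₂, ∀ ρ', (R.recurrentStep v)^[m + 1] (s, ρ₂) ≠ (s, ρ')) → ρ₁ = ρ₂ := by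
      intro ρ₁ ρ₂ n₁ n₂ h₁ h₂ hle h hmin
      obtain ⟨d, rfl⟩ := Nat.exists_eq_add_of_le hle
      rw [show n₁ + d + 1 = n₁ + 1 + d by omega, Function.iterate_add_apply _ (n₁ + 1) d] at h
      have hd := (R.injOn_recurrentStep v).iterate (R.mapsTo_recurrentStep v) (n₁ + 1)
        ((hac _).1 h₁) ((R.mapsTo_recurrentStep v).iterate d ((hac _).1 h₂)) h
      cases d with
      | zero => exact congrArg Prod.snd hd
      | succ d => exact absurd hd.symm (hmin d (by omega) ρ₁)
    rw [heq, ← hn₂] at hn₁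
    rcases le_total n₁ n₂ with hle | hle
    · exact key h₁ h₂ hle hn₁ hmin₂
    · exact (key h₂ h₁ hle hn₁.symm hmin₁).symm
  refine ⟨hmaps, hinj, ?_⟩
  have hsurj : Function.Surjective (hmaps.restrict _ _ _) :=
    Finite.surjective_of_injective (hmaps.restrict_inj.2 hinj)
  exact (hmaps.restrict_surjective_iff).1 hsurj

end CyclicOrdering

end MultiDigraph

namespace MultiDigraph

/-! ### Full turns of a rotor and potentials on edges. -/

namespace CyclicOrdering

variable {V : Type*} {E : Type*} {G : MultiDigraph V E} (R : G.CyclicOrdering)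

theorem iterate_bijOn [Finite E] (e : E) :
    Set.BijOn (fun i => R.next^[i] e) (Set.Iio (Function.minimalPeriod R.next e))
      {f | G.tail f = G.tail e} := by
  refine ⟨fun i _ => R.tail_iterate e i, Function.iterate_injOn_Iio_minimalPeriod, ?_⟩
  intro f hf
  obtain ⟨n, rfl⟩ := R.exists_iterate_eq (e := e) (f := f) (Eq.symm hf)
  have hpos : 0 < Function.minimalPeriod R.next e :=
    Function.minimalPeriod_pos_of_mem_periodicPts
      (Function.Injective.mem_periodicPts R.next.injective e)
  exact ⟨n % Function.minimalPeriod R.next e, Nat.mod_lt _ hpos,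
    Function.iterate_mod_minimalPeriod_eq⟩

theorem minimalPeriod_next [Finite E] (e : E) :
    Function.minimalPeriod R.next e = G.outdeg (G.tail e) := by
  have h := Nat.card_congr ((R.iterate_bijOn e).equiv _)
  rwa [Nat.card_coe_set_eq, Set.ncard_Iio_nat] at h

theorem iterate_outdeg [Finite E] (e : E) : R.next^[G.outdeg (G.tail e)] e = e := by
  rw [← R.minimalPeriod_next]
  exact Function.iterate_minimalPeriod

open Classical in
theorem sum_iterate [Fintype E] {M : Type*} [AddCommMonoid M] (e : E) (F : E → M) :
    ∑ i ∈ Finset.range (G.outdeg (G.tail e)), F (R.next^[i + 1] e) =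
      ∑ f with G.tail f = G.tail e, F f := by
  have h := R.iterate_bijOn (R.next e)
  rw [minimalPeriod_next, tail_next] at h
  refine Finset.sum_nbij (fun i => R.next^[i + 1] e) ?_ ?_ ?_ fun _ _ => rfl
  · intro i _
    simp [tail_iterate, tail_next]
  · simpa using h.injOn
  · simpa using h.surjOn

open Classical in
-- Increments along the cycles of `R.next` integrate to a function exactly when they sum to zero
-- over each cycle; `h` is the partial sum from a base edge.
theorem exists_potential [Fintype E] {M : Type*} [AddCommGroup M] (g : E → M)
    (hg : ∀ e, ∑ f with G.tail f = G.tail e, g f = 0) :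
    ∃ h : E → M, ∀ e, h (R.next e) = h e + g (R.next e) := by
  cases isEmpty_or_nonempty E with
  | inl _ => exact ⟨0, fun e => isEmptyElim e⟩
  | inr _ =>
  let S : E → ℕ → M := fun b k => ∑ i ∈ Finset.range k, g (R.next^[i + 1] b)
  have hadd : ∀ b k l, S b (k + l) = S b k + S (R.next^[k] b) l := by
    intro b k l
    simp only [S, Finset.sum_range_add]
    congr 1
    refine Finset.sum_congr rfl fun i _ => ?_
    rw [← Function.iterate_add_apply]
    congr 2
    omega
  have hzero : ∀ b k, R.next^[k] b = b → S b k = 0 := by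
    intro b k hk
    have hdvd : Function.minimalPeriod R.next b ∣ k := Function.IsPeriodicPt.minimalPeriod_dvd hk
    obtain ⟨q, rfl⟩ := hdvd
    rw [R.minimalPeriod_next]
    clear hk
    induction q with
    | zero => simp [S]
    | succ q ih =>
      have hper : R.next^[G.outdeg (G.tail b) * q] b = b :=
        Function.IsPeriodicPt.mul_const (R.iterate_outdeg b) q
      rw [Nat.mul_succ, hadd, ih, hper, zero_add]
      exact (R.sum_iterate b g).trans (hg b)
  have hle : ∀ b k l, k ≤ l → R.next^[k] b = R.next^[l] b → S b k = S b l := by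
    intro b k l hkl h
    obtain ⟨d, rfl⟩ := Nat.exists_eq_add_of_le hkl
    rw [hadd, hzero (R.next^[k] b) d, add_zero]
    rw [← Function.iterate_add_apply, add_comm, ← h]
  have heq : ∀ b k l, R.next^[k] b = R.next^[l] b → S b k = S b l := fun b k l h =>
    (le_total k l).elim (fun hkl => hle b k l hkl h) fun hlk => (hle b l k hlk h.symm).symm
  -- The base edge depends only on the tail, so `e` and `R.next e` share it.
  let b : E → E := fun e => Function.invFun G.tail (G.tail e)
  have hb : ∀ e, ∃ k : ℕ, R.next^[k] (b e) = e := fun e =>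
    R.exists_iterate_eq (Function.invFun_eq ⟨e, rfl⟩)
  choose k hk using hb
  refine ⟨fun e => S (b e) (k e), fun e => ?_⟩
  have hbn : b (R.next e) = b e := by simp only [b, R.tail_next]
  have h1 : S (b e) (k (R.next e)) = S (b e) (k e + 1) := by
    refine heq _ _ _ ?_
    rw [Function.iterate_succ_apply', hk, ← hbn, hk]
  simp only [hbn, h1]
  rw [hadd, hk]
  simp [S]

theorem advance_iterate_self (ρ : G.RotorConfig) (v : G.NonSink) (k : ℕ) :
    ((fun ρ => R.advance ρ v)^[k] ρ v : E) = R.next^[k] (ρ v) := by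
  induction k with
  | zero => rfl
  | succ k ih => rw [Function.iterate_succ_apply', Function.iterate_succ_apply', advance_self, ih]

theorem advance_iterate_of_ne (ρ : G.RotorConfig) {u v : G.NonSink} (h : u ≠ v) (k : ℕ) :
    (fun ρ => R.advance ρ v)^[k] ρ u = ρ u := by
  induction k with
  | zero => rfl
  | succ k ih => rw [Function.iterate_succ_apply', R.advance_of_ne _ h, ih]

theorem routes_advance_iterate (ρ : G.RotorConfig) (v : G.NonSink) (k : ℕ) :
    Relation.ReflTransGen R.Fires (k • G.chipAt v, ρ)
      (∑ i ∈ Finset.range k, G.chipAt (G.head (R.next^[i + 1] (ρ v))),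
        (fun ρ => R.advance ρ v)^[k] ρ) := by
  induction k with
  | zero => simpa using Relation.ReflTransGen.refl
  | succ k ih =>
    have h := R.routes_add_right (G.chipAt v) ih
    have h' := R.fires_chipAt_add v (∑ i ∈ Finset.range k, G.chipAt (G.head (R.next^[i + 1] (ρ v))))
      ((fun ρ => R.advance ρ v)^[k] ρ)
    rw [add_comm (G.chipAt _), R.advance_iterate_self, ← Function.iterate_succ_apply' R.next,
      ← Finset.sum_range_succ (fun i => G.chipAt (G.head (R.next^[i + 1] (ρ v)))),
      ← Function.iterate_succ_apply' (fun ρ => R.advance ρ v)] at h'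
    rw [succ_nsmul]
    exact h.tail h'

end CyclicOrdering

/-! ### Laplacian rows as relations between chip classes. -/

section Laplacian

variable {V : Type*} {E : Type*} (G : MultiDigraph V E)

/-- The chips received by the neighbors of `v` when every edge with tail `v` carries one chip. -/
noncomputable def headChips (v : V) : G.ChipConfig := fun u => G.edgeCount v u

open Classical in
theorem sum_chipAt_head [Fintype E] (v : V) :
    ∑ f with G.tail f = v, G.chipAt (G.head f) = G.headChips v := by
  funext u
  rw [Finset.sum_apply, headChips, edgeCount, Nat.card_eq_fintype_card, Fintype.card_subtype]
  simp only [chipAt]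
  rw [Finset.sum_boole, Finset.filter_filter]
  simp only [eq_comm, Nat.cast_id]

theorem reducedLaplacian_row (v : G.NonSink) :
    G.reducedLaplacian v = (fun u => ((G.outdeg v • G.chipAt v : G.ChipConfig) u : ℤ)) -
      fun u => (G.headChips v u : ℤ) := by
  funext u
  by_cases h : u = v
  · subst h
    simp [reducedLaplacian, laplacian, headChips, chipAt_self]
  · have h' : (v : V) ≠ u := fun h' => h (Subtype.ext h'.symm)
    simp [reducedLaplacian, laplacian, headChips, h', G.chipAt_of_ne h]

theorem chipClass_outdeg_nsmul (v : G.NonSink) :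
    G.outdeg v • G.chipClass (G.chipAt v) = G.chipClass (G.headChips v) := by
  rw [← chipClass_nsmul, chipClass, chipClass, eq_comm, QuotientAddGroup.eq, neg_add_eq_sub,
    ← reducedLaplacian_row]
  exact AddSubgroup.subset_closure ⟨v, rfl⟩

end Laplacian

/-! ### The firing invariant, and routes between arbitrary rotor configurations. -/

namespace CyclicOrdering

variable {V : Type*} {E : Type*} {G : MultiDigraph V E} (R : G.CyclicOrdering)

theorem routes_outdeg [Finite E] (v : G.NonSink) (ρ : G.RotorConfig) :
    Relation.ReflTransGen R.Fires (G.outdeg v • G.chipAt v, ρ)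
      (G.headChips v, ρ) := by
  classical
  have := Fintype.ofFinite E
  have h := R.routes_advance_iterate ρ v (G.outdeg v)
  have htail : G.tail (ρ v) = v := (ρ v).2
  have hρ : (fun ρ => R.advance ρ v)^[G.outdeg v] ρ = ρ := by
    funext u
    by_cases hu : u = v
    · subst hu
      refine Subtype.ext ?_
      rw [R.advance_iterate_self]
      simpa only [htail] using R.iterate_outdeg (ρ u)
    · exact R.advance_iterate_of_ne ρ hu _
  have hsum := R.sum_iterate (ρ v) fun f => G.chipAt (G.head f)
  rw [htail, sum_chipAt_head] at hsum
  rwa [hρ, hsum] at h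

/-- This is the source of freeness. A firing changes the chip class by `[head] - [tail]`; the
potential `h` is chosen so that the rotor that turns contributes the opposite change. Its increments
sum to zero around a vertex by the Laplacian relation. -/
theorem chipClass_eq_of_routesTo [Finite V] [Finite E] {σ κ : G.ChipConfig}
    {ρ ρ' : G.RotorConfig} (hσ : R.RoutesTo σ ρ ρ') (hκ : R.RoutesTo κ ρ ρ') :
    G.chipClass σ = G.chipClass κ := by
  classical
  have := Fintype.ofFinite V
  have := Fintype.ofFinite E
  obtain ⟨h, hh⟩ := R.exists_potential
    (fun f => G.chipClass (G.chipAt (G.tail f)) - G.chipClass (G.chipAt (G.head f))) (by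
      intro e
      have hns : ¬ G.IsSink (G.tail e) := fun hs => hs e rfl
      rw [Finset.sum_sub_distrib, ← chipClass_sum _ _ fun f => G.chipAt (G.head f),
        sum_chipAt_head, ← chipClass_outdeg_nsmul G ⟨_, hns⟩, sub_eq_zero,
        Finset.sum_congr rfl fun f hf => by rw [(Finset.mem_filter.1 hf).2], Finset.sum_const]
      congr 1
      rw [outdeg, Nat.card_eq_fintype_card, Fintype.card_subtype])
  let w : G.RotorConfig → G.SandpileGroup := fun ρ => ∑ v, h (ρ v)
  have hadv : ∀ ρ v, w (R.advance ρ v) = w ρ + (G.chipClass (G.chipAt v) -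
      G.chipClass (G.chipAt (G.head (R.next (ρ v))))) := by
    intro ρ v
    rw [← sub_eq_iff_eq_add', ← Finset.sum_sub_distrib, Finset.sum_eq_single v]
    · rw [R.advance_self, hh, add_sub_cancel_left, R.tail_next, (ρ v).2]
    · intro u _ hu
      rw [R.advance_of_ne ρ hu, sub_self]
    · simp
  have hinv : ∀ {x y}, Relation.ReflTransGen R.Fires x y →
      G.chipClass y.1 + w y.2 = G.chipClass x.1 + w x.2 := by
    intro x y hxy
    induction hxy with
    | refl => rfl
    | @tail y z _ hyz ih =>
      rw [← ih]
      obtain ⟨σ, ρ⟩ := y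
      obtain ⟨v, τ, rfl, rfl⟩ := R.fires_iff.1 hyz
      simp only [hadv, chipClass_add]
      abel
  exact add_right_cancel ((hinv hσ).symm.trans (hinv hκ))

/-- Chips may be supplied freely, so the rotors can be turned to their targets one vertex at a time;
surplus chips stay unfired. -/
theorem exists_routes [Finite V] [Finite E] (ρ ρ' : G.RotorConfig) :
    ∃ α β, Relation.ReflTransGen R.Fires (α, ρ) (β, ρ') := by
  classical
  have := Fintype.ofFinite V
  have h : ∀ t : Finset G.NonSink, ∃ α β ρ₁, Relation.ReflTransGen R.Fires (α, ρ) (β, ρ₁) ∧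
      ∀ v ∈ t, ρ₁ v = ρ' v := by
    intro t
    induction t using Finset.induction_on with
    | empty => exact ⟨0, 0, ρ, .refl, by simp⟩
    | insert v t _ ih =>
      obtain ⟨α, β, ρ₁, hr, heq⟩ := ih
      obtain ⟨n, hn⟩ := R.exists_iterate_eq ((ρ₁ v).2.trans (ρ' v).2.symm)
      have h1 := R.routes_add_right (n • G.chipAt v) hr
      have h2 := R.routes_add_right β (R.routes_advance_iterate ρ₁ v n)
      rw [add_comm] at h2
      refine ⟨_, _, _, h1.trans h2, fun u hu => ?_⟩
      by_cases huv : u = v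
      · subst huv
        exact Subtype.ext ((R.advance_iterate_self ρ₁ u n).trans hn)
      · rw [R.advance_iterate_of_ne ρ₁ huv]
        exact heq u ((Finset.mem_insert.1 hu).resolve_left huv)
  obtain ⟨α, β, ρ₁, hr, heq⟩ := h Finset.univ
  obtain rfl : ρ₁ = ρ' := funext fun v => heq v (Finset.mem_univ v)
  exact ⟨α, β, hr⟩

end CyclicOrdering
end MultiDigraph

namespace MultiDigraph

/-! ### The action of the sandpile group on trees. -/

namespace CyclicOrdering

variable {V : Type*} {E : Type*} {G : MultiDigraph V E} (R : G.CyclicOrdering)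

/-- The permutation `π` of the oriented spanning trees sends `ρ` to `σ(ρ)`. -/
def ActsAs (σ : G.ChipConfig) (π : Equiv.Perm G.OrientedSpanningTree) : Prop :=
  ∀ T, R.RoutesTo σ (G.treeEquiv.symm T).1 (G.treeEquiv.symm (π T)).1

variable {R}

theorem ActsAs.unique {σ : G.ChipConfig} {π π' : Equiv.Perm G.OrientedSpanningTree}
    (h : R.ActsAs σ π) (h' : R.ActsAs σ π') : π = π' :=
  Equiv.ext fun T => G.treeEquiv.symm.injective (Subtype.ext (RoutesTo.unique R (h T) (h' T)))

theorem ActsAs.mul {σ τ : G.ChipConfig} {π π' : Equiv.Perm G.OrientedSpanningTree}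
    (h : R.ActsAs σ π) (h' : R.ActsAs τ π') : R.ActsAs (σ + τ) (π * π') := fun T => by
  rw [add_comm]
  exact RoutesTo.add R (h' T) (h (π' T))

theorem actsAs_one : R.ActsAs 0 1 := fun _ => R.routesTo_zero _

theorem ActsAs.commute {σ τ : G.ChipConfig} {π π' : Equiv.Perm G.OrientedSpanningTree}
    (h : R.ActsAs σ π) (h' : R.ActsAs τ π') : Commute π π' :=
  (h.mul h').unique (by rw [add_comm]; exact h'.mul h)

theorem ActsAs.routesTo_iff {σ : G.ChipConfig} {π : Equiv.Perm G.OrientedSpanningTree}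
    (h : R.ActsAs σ π) (ρ : {ρ : G.RotorConfig // G.IsAcyclicRotor ρ}) (ρ' : G.RotorConfig) :
    R.RoutesTo σ ρ ρ' ↔ (π (G.treeEquiv ρ) : Set E) = G.rotorEdges ρ' := by
  have hT := h (G.treeEquiv ρ)
  rw [Equiv.symm_apply_apply] at hT
  have hval : ∀ T : G.OrientedSpanningTree, (T : Set E) = G.rotorEdges (G.treeEquiv.symm T).1 := fun T => by
    conv_lhs => rw [← G.treeEquiv.apply_symm_apply T]
    rfl
  rw [hval, G.rotorEdges_injective.eq_iff]
  exact ⟨RoutesTo.unique R hT, fun h => h ▸ hT⟩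

theorem isChipAdditionPerm_iff [Finite V] [Finite E] {s : V} (hs : G.IsGlobalSink s)
    {v : G.NonSink} {π : Equiv.Perm G.OrientedSpanningTree} :
    R.IsChipAdditionPerm v π ↔ R.ActsAs (G.chipAt v) π := by
  have hv := fun ρ => R.routesTo_chipAddition (R.reachesSink hs v ρ)
  constructor
  · intro h T
    have hT := h (G.treeEquiv.symm T)
    rw [Equiv.apply_symm_apply] at hT
    have : (G.treeEquiv.symm (π T)).1 = R.chipAddition v (G.treeEquiv.symm T).1 := by
      refine G.rotorEdges_injective (Eq.trans ?_ hT)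
      exact congrArg Subtype.val (G.treeEquiv.apply_symm_apply (π T))
    rw [this]
    exact hv _
  · exact fun h ρ => (h.routesTo_iff ρ _).1 (hv ρ)

variable (R)

theorem exists_actsAs_chipAt [Finite V] [Finite E] {s : V} (hs : G.IsGlobalSink s)
    (v : G.NonSink) : ∃ π, R.ActsAs (G.chipAt v) π := by
  refine ⟨G.treeEquiv.permCongr ((R.bijOn_chipAddition hs v).equiv _), fun T => ?_⟩
  rw [Equiv.permCongr_apply, Equiv.symm_apply_apply]
  exact R.routesTo_chipAddition (R.reachesSink hs v _)

/-- The commuting permutations `E_v` define a map on integer vectors. It kills each Laplacian row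
because `outdeg v` chips at `v` can first be routed to `headChips v` with the rotors restored. -/
theorem exists_hom_actsAs [Finite V] [Finite E] {s : V} (hs : G.IsGlobalSink s) :
    ∃ θ : Multiplicative G.SandpileGroup →* Equiv.Perm G.OrientedSpanningTree,
      ∀ σ, R.ActsAs σ (θ (Multiplicative.ofAdd (G.chipClass σ))) := by
  classical
  have := Fintype.ofFinite V
  choose p hp using R.exists_actsAs_chipAt hs
  have hcomm : Pairwise fun v w => ∀ x y : ℤ,
      AddCommute (zmultiplesHom _ (Additive.ofMul (p v)) x)
        (zmultiplesHom _ (Additive.ofMul (p w)) y) := by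
    intro v w _ x y
    have h : AddCommute (Additive.ofMul (p v)) (Additive.ofMul (p w)) :=
      congrArg Additive.ofMul (((hp v).commute (hp w)).eq)
    exact (h.zsmul_left x).zsmul_right y
  -- The permutation group is not commutative, so the product over vertices needs the pairwise
  -- commutation `hcomm`.
  let f : (G.NonSink → ℤ) →+ Additive (Equiv.Perm G.OrientedSpanningTree) :=
    AddMonoidHom.noncommPiCoprod (fun v => zmultiplesHom _ (Additive.ofMul (p v))) hcomm
  have hf : ∀ σ : G.ChipConfig, R.ActsAs σ (f fun v => (σ v : ℤ)).toMul := by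
    intro σ
    induction σ using G.chipConfig_induction with
    | zero =>
      have : (fun v : G.NonSink => (((0 : G.ChipConfig) v : ℕ) : ℤ)) = 0 := rfl
      rw [this, map_zero]
      exact actsAs_one
    | add σ τ hσ hτ =>
      have : (fun v => ((σ + τ) v : ℤ)) = (fun v => (σ v : ℤ)) + fun v => (τ v : ℤ) := by
        funext v
        simp
      rw [this, map_add]
      exact hσ.mul hτ
    | chip v =>
      have : (fun u => (G.chipAt v u : ℤ)) = Pi.single v 1 := by
        funext u
        by_cases h : u = v
        · subst h; simp [chipAt_self]
        · simp [G.chipAt_of_ne h, h]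
      rw [this]
      have hv : f (Pi.single v 1) = Additive.ofMul (p v) :=
        (AddMonoidHom.noncommPiCoprod_single _ _ _).trans (by simp)
      rw [hv]
      exact hp v
  have hker : AddSubgroup.closure (Set.range fun v => G.reducedLaplacian v) ≤ f.ker := by
    rw [AddSubgroup.closure_le]
    rintro _ ⟨v, rfl⟩
    change f (G.reducedLaplacian v) = 0
    rw [reducedLaplacian_row, map_sub, sub_eq_zero]
    have h := hf (G.outdeg v • G.chipAt v)
    have h' : R.ActsAs (G.headChips v)
        (f fun u => ((G.outdeg v • G.chipAt v : G.ChipConfig) u : ℤ)).toMul :=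
      fun T => RoutesTo.of_routes R (h T) (R.routes_outdeg v _)
    exact congrArg Additive.ofMul (h'.unique (hf (G.headChips v)))
  exact ⟨AddMonoidHom.toMultiplicativeLeft (QuotientAddGroup.lift _ f hker), hf⟩

end CyclicOrdering

/-- Positive and negative parts write each class as a difference of chip configurations, the only
vectors for which routing is defined. -/
theorem exists_chipClass_eq_add {V : Type*} {E : Type*} (G : MultiDigraph V E)
    (g : G.SandpileGroup) : ∃ σ κ, G.chipClass σ = g + G.chipClass κ := by
  obtain ⟨x, rfl⟩ := QuotientAddGroup.mk_surjective g
  refine ⟨fun v => (x v).toNat, fun v => (-x v).toNat, ?_⟩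
  rw [chipClass, chipClass, ← QuotientAddGroup.mk_add]
  congr 1
  funext v
  simp only [Pi.add_apply]
  omega

end MultiDigraph

/-! ### Assembly of the main theorem. -/

open MultiDigraph CyclicOrdering

theorem mainTheorem3 {V : Type*} {E : Type*} [Finite V] [Finite E]
    (G : MultiDigraph V E) (s : V) (hs : G.IsGlobalSink s) (R : G.CyclicOrdering) :
    -- every chip reaches the sink, and `σ(ρ)` does not depend on the order of the routings
    (∀ v ρ, R.ReachesSink v ρ) ∧
    (∀ σ ρ, ∃! ρ', R.RoutesTo σ ρ ρ') ∧
    -- each `E_v` permutes the (nonempty) set of acyclic rotor configurations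
    (∀ v, Set.BijOn (R.chipAddition v) {ρ | G.IsAcyclicRotor ρ} {ρ | G.IsAcyclicRotor ρ}) ∧
    Nonempty G.OrientedSpanningTree ∧
    -- the sandpile group is isomorphic to the rotor-router group, through the action `σ(ρ)`
    ∃ Φ : Multiplicative G.SandpileGroup ≃* R.rotorRouterGroup,
      (∀ v, R.IsChipAdditionPerm v (Φ (Multiplicative.ofAdd (G.chipClass (G.singleChip v))))) ∧
      (∀ (σ : G.ChipConfig) (ρ : {ρ : G.RotorConfig // G.IsAcyclicRotor ρ}) (ρ' : G.RotorConfig),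
        R.RoutesTo σ ρ ρ' ↔
          ((Φ (Multiplicative.ofAdd (G.chipClass σ)) : Equiv.Perm G.OrientedSpanningTree)
            (G.treeEquiv ρ) : Set E) = G.rotorEdges ρ') ∧
      -- this action is transitive
      (∀ T T' : G.OrientedSpanningTree, ∃ σ : G.ChipConfig,
        (Φ (Multiplicative.ofAdd (G.chipClass σ)) : Equiv.Perm G.OrientedSpanningTree) T = T') ∧
      -- this action is free
      (∀ (g : Multiplicative G.SandpileGroup) (T : G.OrientedSpanningTree),
        (Φ g : Equiv.Perm G.OrientedSpanningTree) T = T → g = 1) := by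
  have hne : Nonempty G.OrientedSpanningTree :=
    (G.exists_isAcyclicRotor hs).elim fun ρ hρ => ⟨G.treeEquiv ⟨ρ, hρ⟩⟩
  refine ⟨R.reachesSink hs, R.existsUnique_routesTo hs, R.bijOn_chipAddition hs, hne, ?_⟩
  obtain ⟨θ, hθ⟩ := R.exists_hom_actsAs hs
  have hfree : ∀ g T, θ g T = T → g = 1 := by
    intro g T hg
    -- With `g = [σ] - [κ]`, fixing `T` means that `σ` and `κ` send `T` to the same tree, so the
    -- invariant gives `[σ] = [κ]`.
    obtain ⟨σ, κ, hσκ⟩ := G.exists_chipClass_eq_add g.toAdd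
    have hmul : θ (Multiplicative.ofAdd (G.chipClass σ)) =
        θ (Multiplicative.ofAdd (G.chipClass κ)) * θ g := by
      rw [hσκ, add_comm, ofAdd_add, map_mul]
      rfl
    have hT := hθ σ T
    rw [hmul, Equiv.Perm.mul_apply, hg] at hT
    rw [R.chipClass_eq_of_routesTo hT (hθ κ T)] at hσκ
    exact congrArg Multiplicative.ofAdd (left_eq_add.1 (hσκ.trans (add_comm _ _)) :)
  have hinj : Function.Injective θ :=
    (injective_iff_map_eq_one θ).2 fun g hg => hfree g hne.some (by rw [hg]; rfl)
  have hrange : θ.range = R.rotorRouterGroup := by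
    apply le_antisymm
    · rintro _ ⟨g, rfl⟩
      have hmem : ∀ σ, θ (Multiplicative.ofAdd (G.chipClass σ)) ∈ R.rotorRouterGroup := by
        intro σ
        induction σ using G.chipConfig_induction with
        | zero => rw [chipClass_zero, ofAdd_zero, map_one]; exact one_mem _
        | add σ τ hσ hτ => rw [chipClass_add, ofAdd_add, map_mul]; exact mul_mem hσ hτ
        | chip v => exact Subgroup.subset_closure ⟨v, (isChipAdditionPerm_iff hs).2 (hθ _)⟩
      obtain ⟨σ, κ, hσκ⟩ := G.exists_chipClass_eq_add g.toAdd
      have hg : g = Multiplicative.ofAdd (G.chipClass σ) *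
          (Multiplicative.ofAdd (G.chipClass κ))⁻¹ := by
        rw [hσκ, ofAdd_add, mul_inv_cancel_right]
        rfl
      rw [hg, map_mul, map_inv]
      exact mul_mem (hmem σ) (inv_mem (hmem κ))
    · refine (Subgroup.closure_le _).2 ?_
      rintro π ⟨v, hπ⟩
      exact ⟨_, (hθ _).unique ((isChipAdditionPerm_iff hs).1 hπ)⟩
  refine ⟨(MonoidHom.ofInjective hinj).trans (MulEquiv.subgroupCongr hrange), fun v => ?_,
    fun σ => (hθ σ).routesTo_iff, fun T T' => ?_, hfree⟩
  · rw [singleChip_eq]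
    exact (isChipAdditionPerm_iff hs).2 (hθ _)
  · obtain ⟨α, β, h⟩ := R.exists_routes (G.treeEquiv.symm T).1 (G.treeEquiv.symm T').1
    -- Routing `α` from `T` can pass through the rotors of `T'` with `β` still to be routed.
    have hαβ : θ (Multiplicative.ofAdd (G.chipClass α)) T =
        θ (Multiplicative.ofAdd (G.chipClass β)) T' :=
      G.treeEquiv.symm.injective (Subtype.ext
        (RoutesTo.unique R (RoutesTo.of_routes R (hθ α T) h) (hθ β T')))
    have hpos := orderOf_pos (θ (Multiplicative.ofAdd (G.chipClass β)))
    -- Adding `β` another `orderOf - 1` times inverts its action with nonnegative numbers of chips.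
    refine ⟨(orderOf (θ (Multiplicative.ofAdd (G.chipClass β))) - 1) • β + α, ?_⟩
    change θ _ T = T'
    rw [chipClass_add, chipClass_nsmul, ofAdd_add, ofAdd_nsmul, map_mul, map_pow,
      Equiv.Perm.mul_apply, hαβ, ← Equiv.Perm.mul_apply, ← pow_succ, Nat.sub_add_cancel hpos,
      pow_orderOf_eq_one, Equiv.Perm.one_apply]
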